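/- Let $n\ge 1$ and $N\ge 0$ be integers. On $V_a\otimes\mathcal H$, with $V_a=\mathbb C^n$ and $\mathcal H=\bigotimes_{m=1}^N V_m$, $V_m=\mathbb C^n$, put $R_{a,m}(\lambda)=\lambda I+\eta\,\mathbb P_{a,m}$, where $\mathbb P_{a,m}$ exchanges $V_a$ and $V_m$. For a matrix $K\in \mathrm{End}(\mathbb C^n)$ whose eigenvalues, counted with algebraic multiplicity, are $\mathsf k_1,\dots,\mathsf k_n$, and for $\xi_1,\dots,\xi_N,\eta\in\mathbb C$, let $$T^{(K)}(\lambda)=\mathrm{tr}_{V_a}\big[K_aR_{a,N}(\lambda-\xi_N)\cdots R_{a,1}(\lambda-\xi_1)\big]\in\mathrm{End}(\mathcal H)$$ be the transfer matrix. A function $t(\lambda)$ is a transfer matrix eigenvalue if there is $v\neq0$ in $\mathcal H$ with $T^{(K)}(\lambda)v=t(\lambda)v$ for all $\lambda\in\mathbb C$. Let $a(\lambda)=\prod_{c=1}^N(\lambda+\eta-\xi_c)$ and, for $i\in\{1,\dots,n\}$, $j\in\{1,\dots,N\}$ and a further point $\xi_{N+1}\in\mathbb C$, define the $N\times N$ matrices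 $$[C^{(t)}_{i,\xi_{N+1}}]_{rs}=-\delta_{rs}\frac{t(\xi_r)}{\mathsf k_i\,a(\xi_r)}+\prod_{\substack{c=1\\ c\ne s}}^{N+1}\frac{\xi_r-\xi_c-\eta}{\xi_s-\xi_c},\qquad [C^{(t|j)}_{i,\xi_{N+1}}]_{rs}=(1-\delta_{sj})[C^{(t)}_{i,\xi_{N+1}}]_{rs}-\delta_{sj}\prod_{\ell=1}^N\frac{\xi_r-\xi_\ell-\eta}{\xi_{N+1}-\xi_\ell},$$ and the normalized determinants $$f_t=\prod_{a=1}^N\prod_{\substack{b=1\\ b\ne a}}^{N+1}(\xi_a-\xi_b)\ \det C^{(t)}_{i,\xi_{N+1}},\qquad g_{t,j}=\prod_{a=1}^N\prod_{\substack{b=1\\ b\ne a}}^{N+1}(\xi_a-\xi_b)\ \det C^{(t|j)}_{i,\xi_{N+1}}.$$ Then, for every $i\in\{1,\dots,n\}$: 1. Whenever $\xi_1,\dots,\xi_N$ are pairwise distinct, $\mathsf k_i\neq0$ and $a(\xi_r)\ne0$ for all $r$, for every transfer matrix eigenvalue $t$ and every $j\in\{1,\dots,N\}$ the functions $f_t$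 and $g_{t,j}$ of $\xi_{N+1}\in\mathbb C\setminus\{\xi_1,\dots,\xi_N\}$ are restrictions of polynomials in $\xi_{N+1}$. 2. For all $\xi_{N+1}\in\mathbb C$ outside a finite set, for Lebesgue-almost all $(\xi_1,\dots,\xi_N,\mathsf k_1,\dots,\mathsf k_n,\eta)\in\mathbb C^{N+n+1}$, for every $K$ with eigenvalues $\mathsf k_1,\dots,\mathsf k_n$, every transfer matrix eigenvalue $t$ and every $j\in\{1,\dots,N\}$, one has $f_t\neq0$ and $g_{t,j}\ne0$. -/

import Mathlib

open scoped Kronecker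

namespace GlnChain

/-- The computational basis of `V_a ⊗ H`, where `V_a = ℂⁿ` is the auxiliary space and
`H = (ℂⁿ)^{⊗ N}` is the quantum space: a basis vector of `V_a` and one for every site. -/
abbrev AuxIndex (n N : ℕ) : Type := Fin n × (Fin N → Fin n)

/-- The permutation operator `P_{a,m}` on `V_a ⊗ H`, exchanging the auxiliary space with
the `m`-th site. -/
noncomputable def swapOp (n N : ℕ) (m : Fin N) : Matrix (AuxIndex n N) (AuxIndex n N) ℂ :=
  Matrix.of fun p q => if p = (q.2 m, Function.update q.2 m q.1) then 1 else 0

/-- The rational `gl_n` R-matrix `R_{a,m}(u) = u I + η P_{a,m}` acting on `V_a ⊗ H`. -/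
noncomputable def rMatrix (n N : ℕ) (η : ℂ) (m : Fin N) (u : ℂ) :
    Matrix (AuxIndex n N) (AuxIndex n N) ℂ :=
  u • (1 : Matrix (AuxIndex n N) (AuxIndex n N) ℂ) + η • swapOp n N m

/-- The twisted monodromy matrix
`M_a(u) = K_a R_{a,N}(u - ξ_N) ⋯ R_{a,1}(u - ξ_1)` (site indices decrease from left to right). -/
noncomputable def monodromy {n N : ℕ} (K : Matrix (Fin n) (Fin n) ℂ) (ξ : Fin N → ℂ) (η u : ℂ) :
    Matrix (AuxIndex n N) (AuxIndex n N) ℂ :=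
  (K ⊗ₖ (1 : Matrix (Fin N → Fin n) (Fin N → Fin n) ℂ)) *
    ((List.finRange N).reverse.map fun m => rMatrix n N η m (u - ξ m)).prod

/-- The transfer matrix `T(u) = tr_{V_a} M_a(u)`, an operator on `H`. -/
noncomputable def transfer {n N : ℕ} (K : Matrix (Fin n) (Fin n) ℂ) (ξ : Fin N → ℂ) (η u : ℂ) :
    Matrix (Fin N → Fin n) (Fin N → Fin n) ℂ :=
  Matrix.of fun σ τ => ∑ α : Fin n, monodromy K ξ η u (α, σ) (α, τ)

/-- The function `t` of the spectral parameter is an eigenvalue of the one-parameter family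
of transfer matrices: there is a common eigenvector `v`, `T(u) v = t(u) v` for all `u`. -/
def IsTransferEigenvalue {n N : ℕ} (K : Matrix (Fin n) (Fin n) ℂ) (ξ : Fin N → ℂ) (η : ℂ)
    (t : ℂ → ℂ) : Prop :=
  ∃ v : (Fin N → Fin n) → ℂ, v ≠ 0 ∧
    ∀ u : ℂ, Matrix.mulVec (transfer K ξ η u) v = t u • v

/-- `a(u) = ∏_a (u + η - ξ_a)`. -/
noncomputable def aFun {N : ℕ} (ξ : Fin N → ℂ) (η u : ℂ) : ℂ := ∏ l : Fin N, (u + η - ξ l)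

/-- The points `ξ_1, …, ξ_N, ξ_{N+1}`, where `ξ_{N+1} = x`. -/
noncomputable def ext {N : ℕ} (ξ : Fin N → ℂ) (x : ℂ) : Fin (N + 1) → ℂ :=
  Fin.snoc (α := fun _ => ℂ) ξ x

/-- The matrix `C^{(t)}_{ξ_{N+1}}`; here `x` is `ξ_{N+1}` and `κ` the chosen twist eigenvalue. -/
noncomputable def cMatrix {N : ℕ} (ξ : Fin N → ℂ) (κ η : ℂ) (t : ℂ → ℂ) (x : ℂ) :
    Matrix (Fin N) (Fin N) ℂ :=
  Matrix.of fun r s =>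
    -(if r = s then t (ξ r) / (κ * aFun ξ η (ξ r)) else 0) +
      ∏ c ∈ Finset.univ.erase s.castSucc,
        (ξ r - ext ξ x c - η) / (ξ s - ext ξ x c)

/-- The matrix `C^{(t|j)}_{ξ_{N+1}}`: the `j`-th column of `C^{(t)}_{ξ_{N+1}}` is replaced by
the right-hand side of the linear system. -/
noncomputable def cMatrixCol {N : ℕ} (ξ : Fin N → ℂ) (κ η : ℂ) (t : ℂ → ℂ) (j : Fin N) (x : ℂ) :
    Matrix (Fin N) (Fin N) ℂ :=
  (cMatrix ξ κ η t x).updateCol j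
    fun r => -∏ l : Fin N, (ξ r - ξ l - η) / (x - ξ l)

/-- The normalization `∏_{a=1}^N ∏_{b=1, b≠a}^{N+1} (ξ_a - ξ_b)`. -/
noncomputable def normalization {N : ℕ} (ξ : Fin N → ℂ) (x : ℂ) : ℂ :=
  ∏ a : Fin N, ∏ b ∈ Finset.univ.erase a.castSucc, (ξ a - ext ξ x b)

/-- The normalized determinant `f_t`, as a function of `x = ξ_{N+1}`. -/
noncomputable def fDet {N : ℕ} (ξ : Fin N → ℂ) (κ η : ℂ) (t : ℂ → ℂ) (x : ℂ) : ℂ :=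
  normalization ξ x * (cMatrix ξ κ η t x).det

/-- The normalized determinant `g_{t,j}`, as a function of `x = ξ_{N+1}`. -/
noncomputable def gDet {N : ℕ} (ξ : Fin N → ℂ) (κ η : ℂ) (t : ℂ → ℂ) (j : Fin N) (x : ℂ) : ℂ :=
  normalization ξ x * (cMatrixCol ξ κ η t j x).det

end GlnChain

namespace GlnChain

open Polynomial Finset

/-! Polynomiality is elementary. The node `x` enters column `s` of `cMatrix` only through `(ξ r - x
- η) / (ξ s - x)`, and the normalization supplies `ξ s - x` for each column. For `g`, subtracting
multiples of column `j` removes `x` from all other columns, so `gDet` is even constant in `x`.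

Nonvanishing comes from the degeneration `η → 0`. For almost all parameters the `k m` are distinct,
so `K` is diagonalizable, and `P ⊗ ⋯ ⊗ P` carries common eigenvectors to those of the diagonal twist
(`IsTransferEigenvalue.of_similar`). If `w` is a null vector of the scalar matrix and `v` the
eigenvector of `t`, then `w ⊗ v` is a null vector of the operator-valued `chainMatrix`, which no
longer mentions `t` (`det_chainMatrix_eq_zero`). Its determinant is a polynomial in `η`, and it
suffices that this polynomial is nonzero.

Each row of `chainMatrix` is divisible by `η`, and the rows `(r, σ)` with `σ r = i` or `r ∈ J` are
divisible once more. A null vector of the matrix of remaining leading coefficients gives, for each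
`σ`, a polynomial `Q` of degree at most `N` that vanishes at `ξ r` when `σ r ≠ i` and satisfies a
first-order condition there when `σ r = i`. These conditions force `Q` to be a multiple of `∏ (X - ξ
l)` over `σ l ≠ i`, and one further zero (`x` for `f`, a double zero at `ξ j` for `g`) forces `Q =
0` (`eq_zero_of_degenerate_curve`, `exists_polynomial_det_chainMatrix`). Fubini turns this into a
statement for almost all parameters. -/

/-! ### Dependence on the additional node -/

lemma prod_erase_castSucc {M : Type*} [CommMonoid M] {N : ℕ} (f : Fin (N + 1) → M) (s : Fin N) :
    ∏ c ∈ univ.erase s.castSucc, f c = (∏ c ∈ univ.erase s, f c.castSucc) * f (Fin.last N) := by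
  have h : (univ.erase s.castSucc : Finset (Fin (N + 1))) =
      Finset.cons (Fin.last N) ((univ.erase s).map Fin.castSuccEmb) (by
        simp [Fin.castSucc_ne_last]) := by
    ext c
    refine Fin.lastCases ?_ (fun c => ?_) c
    · simp [(Fin.castSucc_ne_last s).symm]
    · simp [Fin.castSucc_ne_last]
  rw [h, Finset.prod_cons, Finset.prod_map, mul_comm]
  rfl

@[simp] lemma ext_castSucc {N : ℕ} (ξ : Fin N → ℂ) (x : ℂ) (c : Fin N) :
    ext ξ x c.castSucc = ξ c := by simp [ext]

@[simp] lemma ext_last {N : ℕ} (ξ : Fin N → ℂ) (x : ℂ) : ext ξ x (Fin.last N) = x := by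
  simp [ext]

lemma normalization_eq {N : ℕ} (ξ : Fin N → ℂ) (x : ℂ) :
    normalization ξ x = (∏ a, ∏ b ∈ univ.erase a, (ξ a - ξ b)) * ∏ a, (ξ a - x) := by
  simp only [normalization, prod_erase_castSucc, ext_castSucc, ext_last, Finset.prod_mul_distrib]

/-- The value at `ξ r - η` of the `s`-th Lagrange polynomial of the nodes `ξ`. -/
noncomputable def lagrangeShift {N : ℕ} (ξ : Fin N → ℂ) (η : ℂ) (r s : Fin N) : ℂ :=
  ∏ c ∈ univ.erase s, (ξ r - ξ c - η) / (ξ s - ξ c)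

lemma cMatrix_apply {N : ℕ} (ξ : Fin N → ℂ) (κ η : ℂ) (t : ℂ → ℂ) (x : ℂ) (r s : Fin N) :
    cMatrix ξ κ η t x r s = -(if r = s then t (ξ r) / (κ * aFun ξ η (ξ r)) else 0) +
      lagrangeShift ξ η r s * ((ξ r - x - η) / (ξ s - x)) := by
  simp only [cMatrix, Matrix.of_apply, prod_erase_castSucc, lagrangeShift, ext_castSucc, ext_last]

/-- The part of `cMatrix` that does not depend on the additional node. -/
noncomputable def baseMatrix {N : ℕ} (ξ : Fin N → ℂ) (κ η : ℂ) (t : ℂ → ℂ) :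
    Matrix (Fin N) (Fin N) ℂ :=
  Matrix.of fun r s => -(if r = s then t (ξ r) / (κ * aFun ξ η (ξ r)) else 0) +
    lagrangeShift ξ η r s

/-- The matrix `baseMatrix` with its `j`-th column replaced by the shifted nodal polynomial. -/
noncomputable def baseMatrixCol {N : ℕ} (ξ : Fin N → ℂ) (κ η : ℂ) (t : ℂ → ℂ) (j : Fin N) :
    Matrix (Fin N) (Fin N) ℂ :=
  (baseMatrix ξ κ η t).updateCol j fun r => ∏ l, (ξ r - ξ l - η)

/-- Writing `(ξ r - x - η) / (ξ s - x) = 1 + (ξ r - ξ s - η) / (ξ s - x)`, the second term completes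
the Lagrange numerator to the full nodal product. The dependence on `x` is thus of rank one. -/
lemma cMatrix_eq_base_add {N : ℕ} (ξ : Fin N → ℂ) (κ η : ℂ) (t : ℂ → ℂ) {x : ℂ}
    (hx : x ∉ Set.range ξ) (r s : Fin N) :
    cMatrix ξ κ η t x r s = baseMatrix ξ κ η t r s +
      (∏ l, (ξ r - ξ l - η)) * ((∏ c ∈ univ.erase s, (ξ s - ξ c))⁻¹ * (ξ s - x)⁻¹) := by
  have h : ξ s - x ≠ 0 := sub_ne_zero.2 fun h => hx ⟨s, h⟩
  rw [cMatrix_apply, baseMatrix, Matrix.of_apply, add_assoc]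
  congr 1
  rw [← Finset.mul_prod_erase univ (fun l => ξ r - ξ l - η) (Finset.mem_univ s), lagrangeShift,
    Finset.prod_div_distrib, div_eq_mul_inv, div_eq_mul_inv]
  have : ξ r - x - η = (ξ s - x) + (ξ r - ξ s - η) := by ring
  rw [this, add_mul, mul_inv_cancel₀ h]
  ring

lemma det_cMatrixCol {N : ℕ} (ξ : Fin N → ℂ) (κ η : ℂ) (t : ℂ → ℂ) (j : Fin N) {x : ℂ}
    (hx : x ∉ Set.range ξ) :
    (cMatrixCol ξ κ η t j x).det =
      -(∏ l, (x - ξ l))⁻¹ * (baseMatrixCol ξ κ η t j).det := by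
  have hne : ∀ l, x - ξ l ≠ 0 := fun l => sub_ne_zero.2 fun h => hx ⟨l, h.symm⟩
  have hP : ∏ l, (x - ξ l) ≠ 0 := Finset.prod_ne_zero_iff.2 fun l _ => hne l
  have hcol : cMatrixCol ξ κ η t j x = (cMatrix ξ κ η t x).updateCol j
      ((-(∏ l, (x - ξ l))⁻¹) • fun r => ∏ l, (ξ r - ξ l - η)) := by
    unfold cMatrixCol
    congr 1
    ext r
    simp only [Finset.prod_div_distrib, Pi.smul_apply, smul_eq_mul]
    ring
  rw [hcol, Matrix.det_updateCol_smul]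
  congr 1
  -- Column `j` is now the nodal column, so the rank-one part of every other column is a multiple of
  -- it; transposing turns these column operations into row operations.
  rw [← Matrix.det_transpose, ← Matrix.det_transpose (baseMatrixCol ξ κ η t j)]
  refine Matrix.det_eq_of_forall_row_eq_smul_add_const
    (fun s => if s = j then 0 else (∏ c ∈ univ.erase s, (ξ s - ξ c))⁻¹ * (ξ s - x)⁻¹) j
    (by simp) fun s r => ?_
  rw [Matrix.transpose_apply, Matrix.transpose_apply, Matrix.transpose_apply]
  by_cases hs : s = j
  · subst hs; simp [baseMatrixCol]
  · simp only [baseMatrixCol, Matrix.updateCol_ne hs, Matrix.updateCol_self, if_neg hs,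
      cMatrix_eq_base_add ξ κ η t hx]
    ring

lemma exists_polynomial_gDet {N : ℕ} (ξ : Fin N → ℂ) (κ η : ℂ) (t : ℂ → ℂ) (j : Fin N) :
    ∃ q : ℂ[X], ∀ x, x ∉ Set.range ξ → gDet ξ κ η t j x = q.eval x := by
  -- A constant works: `∏ (ξ a - x)` in the normalization cancels `(∏ (x - ξ l))⁻¹` up to the sign
  -- `(-1) ^ N`.
  refine ⟨C (-(∏ a, ∏ b ∈ univ.erase a, (ξ a - ξ b)) * (-1) ^ N *
    (baseMatrixCol ξ κ η t j).det), fun x hx => ?_⟩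
  have hP : ∏ l, (x - ξ l) ≠ 0 :=
    Finset.prod_ne_zero_iff.2 fun l _ => sub_ne_zero.2 fun h => hx ⟨l, h.symm⟩
  have : ∏ a, (ξ a - x) = (-1) ^ N * ∏ l, (x - ξ l) := by
    simp_rw [← neg_sub x, Finset.prod_neg, Finset.card_univ, Fintype.card_fin]
  rw [gDet, det_cMatrixCol ξ κ η t j hx, normalization_eq, this, eval_C]
  field_simp

lemma exists_polynomial_fDet {N : ℕ} (ξ : Fin N → ℂ) (κ η : ℂ) (t : ℂ → ℂ) :
    ∃ p : ℂ[X], ∀ x, x ∉ Set.range ξ → fDet ξ κ η t x = p.eval x := by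
  -- Column `s` of `cMatrix` multiplied by `ξ s - x`, with `x` as the indeterminate.
  let A : Matrix (Fin N) (Fin N) ℂ[X] := Matrix.of fun r s =>
    C (-(if r = s then t (ξ r) / (κ * aFun ξ η (ξ r)) else 0)) * (C (ξ s) - X) +
      C (lagrangeShift ξ η r s) * (C (ξ r - η) - X)
  refine ⟨C (∏ a, ∏ b ∈ univ.erase a, (ξ a - ξ b)) * A.det, fun x hx => ?_⟩
  rw [fDet, normalization_eq, mul_assoc, ← Matrix.det_mul_row, eval_mul, eval_C,
    ← coe_evalRingHom, RingHom.map_det]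
  congr 2
  ext r s
  have h : ξ s - x ≠ 0 := sub_ne_zero.2 fun h => hx ⟨s, h⟩
  simp only [Matrix.of_apply, cMatrix_apply, A, RingHom.mapMatrix_apply, Matrix.map_apply,
    coe_evalRingHom, eval_add, eval_mul, eval_C, eval_sub, eval_X]
  field_simp
  ring

/-! ### Reduction to a diagonal twist -/

/-- The permutation of the basis of `V_a ⊗ H` that underlies `swapOp`. -/
def swapFun {n N : ℕ} (m : Fin N) (q : AuxIndex n N) : AuxIndex n N :=
  (q.2 m, Function.update q.2 m q.1)

lemma swapFun_swapFun {n N : ℕ} (m : Fin N) (q : AuxIndex n N) : swapFun m (swapFun m q) = q := by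
  simp [swapFun]

lemma mul_swapOp_apply {n N : ℕ} (m : Fin N) (A : Matrix (AuxIndex n N) (AuxIndex n N) ℂ)
    (p q : AuxIndex n N) : (A * swapOp n N m) p q = A p (swapFun m q) := by
  simp [Matrix.mul_apply, swapOp, swapFun]

lemma swapOp_mul_apply {n N : ℕ} (m : Fin N) (A : Matrix (AuxIndex n N) (AuxIndex n N) ℂ)
    (p q : AuxIndex n N) : (swapOp n N m * A) p q = A (swapFun m p) q := by
  have h : ∀ s : AuxIndex n N, p = (s.2 m, Function.update s.2 m s.1) ↔ s = swapFun m p :=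
    fun s => ⟨fun h => by rw [h]; exact (swapFun_swapFun m s).symm,
      fun h => by rw [h]; exact (swapFun_swapFun m p).symm⟩
  simp [Matrix.mul_apply, swapOp, h]

/-- The operator `P ⊗ ⋯ ⊗ P` on the quantum space. -/
def tensorPow {n : ℕ} (N : ℕ) (P : Matrix (Fin n) (Fin n) ℂ) :
    Matrix (Fin N → Fin n) (Fin N → Fin n) ℂ :=
  Matrix.of fun σ τ => ∏ m, P (σ m) (τ m)

lemma tensorPow_mul {n N : ℕ} (P Q : Matrix (Fin n) (Fin n) ℂ) :
    tensorPow N (P * Q) = tensorPow N P * tensorPow N Q := by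
  ext σ τ
  simp only [tensorPow, Matrix.of_apply, Matrix.mul_apply, Finset.prod_univ_sum,
    Fintype.piFinset_univ, Finset.prod_mul_distrib]

lemma tensorPow_one {n N : ℕ} : tensorPow N (1 : Matrix (Fin n) (Fin n) ℂ) = 1 := by
  ext σ τ
  simp only [tensorPow, Matrix.of_apply, Matrix.one_apply, Finset.prod_ite_zero, funext_iff]
  simp

/-- The same `P` acts on the two exchanged factors. -/
lemma kronecker_tensorPow_comm_swapOp {n N : ℕ} (P : Matrix (Fin n) (Fin n) ℂ) (m : Fin N) :
    Commute (P ⊗ₖ tensorPow N P) (swapOp n N m) := by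
  ext ⟨α, σ⟩ ⟨β, τ⟩
  rw [mul_swapOp_apply, swapOp_mul_apply]
  simp only [Matrix.kroneckerMap_apply, swapFun, tensorPow, Matrix.of_apply]
  rw [← Finset.mul_prod_erase univ _ (Finset.mem_univ m),
    ← Finset.mul_prod_erase univ (fun l => P (Function.update σ m α l) (τ l)) (Finset.mem_univ m)]
  have : ∏ l ∈ univ.erase m, P (σ l) (Function.update τ m β l) =
      ∏ l ∈ univ.erase m, P (Function.update σ m α l) (τ l) :=
    Finset.prod_congr rfl fun l hl => by
      simp [Function.update_of_ne (Finset.ne_of_mem_erase hl)]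
  rw [this]
  simp only [Function.update_self]
  ring

lemma kronecker_tensorPow_mul_monodromy {n N : ℕ} {P K D : Matrix (Fin n) (Fin n) ℂ}
    (h : P * K = D * P) (ξ : Fin N → ℂ) (η u : ℂ) :
    (P ⊗ₖ tensorPow N P) * monodromy K ξ η u = monodromy D ξ η u * (P ⊗ₖ tensorPow N P) := by
  have hc : Commute (P ⊗ₖ tensorPow N P)
      ((List.finRange N).reverse.map fun m => rMatrix n N η m (u - ξ m)).prod := by
    refine Commute.list_prod_right _ _ fun A hA => ?_
    obtain ⟨m, -, rfl⟩ := List.mem_map.1 hA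
    exact ((Commute.one_right _).smul_right _).add_right
      ((kronecker_tensorPow_comm_swapOp P m).smul_right _)
  rw [monodromy, monodromy, mul_assoc, ← hc.eq, ← mul_assoc, ← mul_assoc,
    ← Matrix.mul_kronecker_mul, ← Matrix.mul_kronecker_mul, h, mul_one, one_mul]

/-- The partial trace over the auxiliary space. -/
def auxTrace {n N : ℕ} (A : Matrix (AuxIndex n N) (AuxIndex n N) ℂ) :
    Matrix (Fin N → Fin n) (Fin N → Fin n) ℂ :=
  Matrix.of fun σ τ => ∑ α, A (α, σ) (α, τ)

lemma auxTrace_one_kronecker_mul {n N : ℕ} (W : Matrix (Fin N → Fin n) (Fin N → Fin n) ℂ)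
    (A : Matrix (AuxIndex n N) (AuxIndex n N) ℂ) :
    auxTrace ((1 ⊗ₖ W) * A) = W * auxTrace A := by
  ext σ τ
  simp only [auxTrace, Matrix.of_apply, Matrix.mul_apply, Matrix.kroneckerMap_apply,
    Fintype.sum_prod_type_right, Matrix.one_apply, ite_mul, one_mul, zero_mul, Finset.sum_ite_eq,
    Finset.mem_univ, if_true, Finset.mul_sum]
  exact Finset.sum_comm

lemma auxTrace_mul_one_kronecker {n N : ℕ} (W : Matrix (Fin N → Fin n) (Fin N → Fin n) ℂ)
    (A : Matrix (AuxIndex n N) (AuxIndex n N) ℂ) :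
    auxTrace (A * (1 ⊗ₖ W)) = auxTrace A * W := by
  ext σ τ
  simp only [auxTrace, Matrix.of_apply, Matrix.mul_apply, Matrix.kroneckerMap_apply,
    Fintype.sum_prod_type_right, Matrix.one_apply, ite_mul, one_mul, zero_mul, mul_ite, mul_zero,
    Finset.sum_ite_eq', Finset.mem_univ, if_true, Finset.sum_mul]
  exact Finset.sum_comm

lemma auxTrace_mul_kronecker_one {n N : ℕ} (P : Matrix (Fin n) (Fin n) ℂ)
    (A : Matrix (AuxIndex n N) (AuxIndex n N) ℂ) :
    auxTrace (A * (P ⊗ₖ 1)) = auxTrace ((P ⊗ₖ 1) * A) := by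
  ext σ τ
  simp only [auxTrace, Matrix.of_apply, Matrix.mul_apply, Matrix.kroneckerMap_apply,
    Fintype.sum_prod_type, Matrix.one_apply, mul_ite, mul_one, mul_zero, ite_mul, zero_mul,
    Finset.sum_ite_eq', Finset.sum_ite_eq, Finset.mem_univ, if_true]
  rw [Finset.sum_comm]
  exact Finset.sum_congr rfl fun _ _ => Finset.sum_congr rfl fun _ _ => mul_comm _ _

/-- `P ⊗ P^{⊗N}` intertwines the two monodromies; its auxiliary factor is undone by `Q` and
disappears by cyclicity of the partial trace. -/
lemma tensorPow_mul_transfer {n N : ℕ} {P Q K D : Matrix (Fin n) (Fin n) ℂ}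
    (h : P * K = D * P) (hQP : Q * P = 1) (ξ : Fin N → ℂ) (η u : ℂ) :
    tensorPow N P * transfer K ξ η u = transfer D ξ η u * tensorPow N P := by
  have hPQ : P * Q = 1 := mul_eq_one_comm.1 hQP
  have h1 : (1 ⊗ₖ tensorPow N P) * monodromy K ξ η u =
      (Q ⊗ₖ 1) * (monodromy D ξ η u * (1 ⊗ₖ tensorPow N P) * (P ⊗ₖ 1)) := by
    have : (1 ⊗ₖ tensorPow N P : Matrix (AuxIndex n N) (AuxIndex n N) ℂ) =
      (Q ⊗ₖ 1) * (P ⊗ₖ tensorPow N P) := by rw [← Matrix.mul_kronecker_mul, hQP, one_mul]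
    rw [this, mul_assoc, kronecker_tensorPow_mul_monodromy h, ← this, mul_assoc (monodromy D ξ η u),
      ← Matrix.mul_kronecker_mul, one_mul, mul_one]
  have h2 := congrArg auxTrace h1
  rw [auxTrace_one_kronecker_mul, ← auxTrace_mul_kronecker_one, mul_assoc _ (P ⊗ₖ 1),
    ← Matrix.mul_kronecker_mul, hPQ, one_mul, Matrix.one_kronecker_one, mul_one,
    auxTrace_mul_one_kronecker] at h2
  exact h2

lemma IsTransferEigenvalue.of_similar {n N : ℕ} {P Q K D : Matrix (Fin n) (Fin n) ℂ}
    (h : P * K = D * P) (hQP : Q * P = 1) {ξ : Fin N → ℂ} {η : ℂ} {t : ℂ → ℂ}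
    (ht : IsTransferEigenvalue K ξ η t) : IsTransferEigenvalue D ξ η t := by
  obtain ⟨v, hv, hT⟩ := ht
  refine ⟨(tensorPow N P).mulVec v, fun h0 => hv ?_, fun u => ?_⟩
  · rw [← Matrix.one_mulVec v, ← tensorPow_one, ← hQP, tensorPow_mul, ← Matrix.mulVec_mulVec, h0,
      Matrix.mulVec_zero]
  · rw [Matrix.mulVec_mulVec, ← tensorPow_mul_transfer h hQP, ← Matrix.mulVec_mulVec, hT,
      Matrix.mulVec_smul]

lemma exists_diagonalization {n : ℕ} {K : Matrix (Fin n) (Fin n) ℂ} {k : Fin n → ℂ}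
    (hk : Function.Injective k) (hK : K.charpoly = ∏ m, (X - C (k m))) :
    ∃ P Q : Matrix (Fin n) (Fin n) ℂ, P * K = Matrix.diagonal k * P ∧ Q * P = 1 := by
  have hev : ∀ m, Module.End.HasEigenvalue (Matrix.toLin' K) (k m) := fun m => by
    rw [Module.End.hasEigenvalue_iff_isRoot_charpoly, Matrix.charpoly_toLin', hK, IsRoot,
      eval_prod]
    exact Finset.prod_eq_zero (Finset.mem_univ m) (by simp)
  choose u hu using fun m => (hev m).exists_hasEigenvector
  have hli := Module.End.eigenvectors_linearIndependent' (Matrix.toLin' K) k hk u hu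
  set U : Matrix (Fin n) (Fin n) ℂ := Matrix.of fun a b => u b a with hU
  have hKU : K * U = U * Matrix.diagonal k := by
    ext a b
    have := congrFun (hu b).apply_eq_smul a
    rw [Matrix.toLin'_apply] at this
    rw [Matrix.mul_diagonal]
    simpa [Matrix.mul_apply, Matrix.mulVec, dotProduct, hU, mul_comm] using this
  have hunit : IsUnit U := Matrix.linearIndependent_cols_iff_isUnit.1 hli
  obtain ⟨⟨U, V, hUV, hVU⟩, rfl : U = _⟩ := hunit
  refine ⟨V, U, ?_, hUV⟩
  calc V * K = V * (K * U) * V := by rw [mul_assoc, mul_assoc K, hUV, mul_one]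
    _ = _ := by rw [hKU, ← mul_assoc, hVU, one_mul]

/-! ### Expansion of the transfer matrix at a node to first order in `η` -/

section Expansion

variable {n N : ℕ}

/-- The product of the R-matrices of the sites in `l` at the point `ξ r`, as a matrix of
polynomials in `η`. -/
noncomputable def sitesPoly (n : ℕ) (ξ : Fin N → ℂ) (r : Fin N) (l : List (Fin N)) :
    Matrix (AuxIndex n N) (AuxIndex n N) ℂ[X] :=
  (l.map fun m => C (ξ r - ξ m) • (1 : Matrix (AuxIndex n N) (AuxIndex n N) ℂ[X]) +
    (X : ℂ[X]) • (swapOp n N m).map C).prod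

lemma map_eval_sitesPoly (ξ : Fin N → ℂ) (r : Fin N) (l : List (Fin N)) (η : ℂ) :
    (sitesPoly n ξ r l).map (eval η) =
      (l.map fun m => rMatrix n N η m (ξ r - ξ m)).prod := by
  change (evalRingHom η).mapMatrix _ = _
  rw [sitesPoly, map_list_prod, List.map_map]
  congr 2
  ext m p q
  simp [rMatrix, Matrix.one_apply, apply_ite (eval η), mul_comm η]

lemma map_coeff_one_mul {ι : Type*} [Fintype ι] (A B : Matrix ι ι ℂ[X]) :
    (A * B).map (coeff · 1) = A.map (coeff · 0) * B.map (coeff · 1) +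
      A.map (coeff · 1) * B.map (coeff · 0) := by
  ext i j
  simp [Matrix.mul_apply, Polynomial.mul_coeff_one,
    Finset.sum_add_distrib]

lemma map_coeff_zero_mul {ι : Type*} [Fintype ι] (A B : Matrix ι ι ℂ[X]) :
    (A * B).map (coeff · 0) = A.map (coeff · 0) * B.map (coeff · 0) := by
  ext i j
  simp [Matrix.mul_apply, Polynomial.mul_coeff_zero]

lemma map_coeff_zero_sitesPoly (ξ : Fin N → ℂ) (r : Fin N) (l : List (Fin N)) :
    (sitesPoly n ξ r l).map (coeff · 0) =
      (l.map fun m => ξ r - ξ m).prod • (1 : Matrix (AuxIndex n N) (AuxIndex n N) ℂ) := by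
  simp_rw [coeff_zero_eq_eval_zero]
  refine (map_eval_sitesPoly ξ r l 0).trans ?_
  induction l with
  | nil => simp
  | cons m l ih =>
    rw [List.map_cons, List.prod_cons, ih]
    simp [rMatrix, smul_smul, mul_comm]

lemma map_coeff_one_sitesPoly (ξ : Fin N → ℂ) (r : Fin N) (l : List (Fin N))
    (hl : ∀ m ∈ l, ξ r - ξ m ≠ 0) :
    (sitesPoly n ξ r l).map (coeff · 1) =
      (l.map fun m => ξ r - ξ m).prod • (l.map fun m => (ξ r - ξ m)⁻¹ • swapOp n N m).sum := by
  induction l with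
  | nil =>
    ext p q
    simp [sitesPoly, Matrix.one_apply, apply_ite (fun p : ℂ[X] => p.coeff 1), coeff_one]
  | cons m l ih =>
    have hm : ξ r - ξ m ≠ 0 := hl m (by simp)
    have h0 : (C (ξ r - ξ m) • (1 : Matrix (AuxIndex n N) (AuxIndex n N) ℂ[X]) +
        (X : ℂ[X]) • (swapOp n N m).map C).map (coeff · 0) = (ξ r - ξ m) • 1 := by
      ext p q
      simp [Matrix.one_apply, apply_ite (fun p : ℂ[X] => p.coeff 0)]
    have h1 : (C (ξ r - ξ m) • (1 : Matrix (AuxIndex n N) (AuxIndex n N) ℂ[X]) +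
        (X : ℂ[X]) • (swapOp n N m).map C).map (coeff · 1) = swapOp n N m := by
      ext p q
      simp [Matrix.one_apply, apply_ite (fun p : ℂ[X] => p.coeff 1), coeff_C]
    have hs : sitesPoly n ξ r (m :: l) = (C (ξ r - ξ m) •
      (1 : Matrix (AuxIndex n N) (AuxIndex n N) ℂ[X]) + (X : ℂ[X]) • (swapOp n N m).map C) *
        sitesPoly n ξ r l := by simp [sitesPoly]
    rw [hs, map_coeff_one_mul, h0, h1, ih fun a ha => hl a (by simp [ha]),
      map_coeff_zero_sitesPoly]
    simp only [List.map_cons, List.prod_cons, List.sum_cons, smul_add, smul_smul, smul_mul_assoc,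
      one_mul, mul_smul_comm, mul_one]
    rw [mul_right_comm, mul_inv_cancel₀ hm, one_mul, add_comm, mul_comm (ξ r - ξ m)]

/-- This is `tr_a (K_a P_{a,r}) = K_r` for diagonal `K`. -/
lemma sum_mul_swapOp (k : Fin n → ℂ) (r : Fin N) (σ τ : Fin N → Fin n) :
    ∑ α, k α * swapOp n N r (α, σ) (α, τ) = if σ = τ then k (σ r) else 0 := by
  have h : ∀ α, swapOp n N r (α, σ) (α, τ) = if α = τ r then (if σ = τ then 1 else 0) else 0 := by
    intro α
    simp only [swapOp, Matrix.of_apply, Prod.mk.injEq, ite_and]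
    split_ifs with h1 <;> simp_all
  simp only [h, mul_ite, mul_one, mul_zero, Finset.sum_ite_eq', Finset.mem_univ, if_true]
  split_ifs with h1 <;> simp [h1]

/-- The product permutes the labels of the auxiliary space, `r` and `l` by a 3-cycle. If the
auxiliary label and the label at `r` are unchanged, all three labels must coincide. -/
lemma swapOp_mul_swapOp_apply {r l : Fin N} (hrl : r ≠ l) {σ τ : Fin N → Fin n}
    (h : σ r = τ r) (α : Fin n) :
    (swapOp n N l * swapOp n N r) (α, σ) (α, τ) =
      if α = σ r then (if σ = τ ∧ σ l = σ r then 1 else 0) else 0 := by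
  rw [mul_swapOp_apply, ← ite_and]
  refine if_congr ?_ rfl rfl
  simp only [swapFun, Prod.mk.injEq, Function.update_of_ne hrl.symm]
  constructor
  · rintro ⟨rfl, hσ⟩
    have h1 : σ r = τ l := by rw [hσ]; simp [hrl]
    have h2 : σ l = τ r := by rw [hσ]; simp
    refine ⟨h1.symm, funext fun m => ?_, h2.trans h.symm⟩
    by_cases hm : m = l
    · rw [hm, h2, ← h, h1]
    · by_cases hm' : m = r
      · rw [hm', h]
      · rw [hσ]; simp [hm, hm']
  · rintro ⟨rfl, rfl, h2⟩
    refine ⟨h2.symm, funext fun m => ?_⟩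
    by_cases hm : m = l
    · simp [hm, h2]
    · simp [hm]

lemma swapOp_mul_swapOp_apply' {r l : Fin N} (hrl : r ≠ l) {σ τ : Fin N → Fin n}
    (h : σ r = τ r) (α : Fin n) :
    (swapOp n N r * swapOp n N l) (α, σ) (α, τ) =
      if α = σ r then (if σ = τ ∧ σ l = σ r then 1 else 0) else 0 := by
  rw [mul_swapOp_apply, ← ite_and]
  refine if_congr ?_ rfl rfl
  simp only [swapFun, Prod.mk.injEq, Function.update_of_ne hrl]
  constructor
  · rintro ⟨rfl, hσ⟩
    have h1 : σ r = τ l := by rw [hσ]; simp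
    have h2 : σ l = τ r := by rw [hσ]; simp [hrl.symm]
    refine ⟨h.symm, funext fun m => ?_, h2.trans h.symm⟩
    by_cases hm : m = l
    · rw [hm, h2, ← h, h1]
    · by_cases hm' : m = r
      · rw [hm', h]
      · rw [hσ]; simp [hm, hm']
  · rintro ⟨rfl, rfl, h2⟩
    refine ⟨rfl, funext fun m => ?_⟩
    by_cases hm : m = r
    · simp [hm, h2]
    · by_cases hm' : m = l
      · simp [hm', hrl.symm, h2]
      · simp [hm, hm']

lemma monodromy_diagonal_apply (k : Fin n → ℂ) (ξ : Fin N → ℂ) (η u : ℂ) (α : Fin n)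
    (σ : Fin N → Fin n) (q : AuxIndex n N) :
    monodromy (Matrix.diagonal k) ξ η u (α, σ) q =
      k α * ((List.finRange N).reverse.map fun m => rMatrix n N η m (u - ξ m)).prod (α, σ) q := by
  rw [monodromy, ← Matrix.diagonal_one, Matrix.diagonal_kronecker_diagonal, Matrix.diagonal_mul,
    mul_one]

lemma exists_split_finRange (r : Fin N) : ∃ l₁ l₂ : List (Fin N),
    (List.finRange N).reverse = l₁ ++ r :: l₂ ∧ (l₁ ++ l₂).Perm (univ.erase r).toList := by
  obtain ⟨l₁, l₂, h⟩ := List.append_of_mem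
    (show r ∈ (List.finRange N).reverse by simp)
  have hn : (l₁ ++ r :: l₂).Nodup := h ▸ List.nodup_reverse.2 (List.nodup_finRange N)
  have hn' := List.nodup_middle.1 hn
  refine ⟨l₁, l₂, h, (List.perm_ext_iff_of_nodup (List.nodup_cons.1 hn').2
    (Finset.nodup_toList _)).2 fun m => ?_⟩
  have hm : m ∈ l₁ ++ r :: l₂ := h ▸ by simp
  have hr := (List.nodup_cons.1 hn').1
  rw [Finset.mem_toList, Finset.mem_erase]
  constructor
  · intro h
    exact ⟨fun h' => hr (h' ▸ h), Finset.mem_univ m⟩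
  · rintro ⟨h, -⟩
    simpa [h] using hm

/-- At `u = ξ r` the factor of site `r` is `η P_{a,r}`, which gives the overall `η`. The first-order
term contains `P_{a,m} P_{a,r}` or `P_{a,r} P_{a,m}` according to the side of `r` on which `m`
stands; on entries with `σ r = τ r` both orders agree, and only those entries are needed later. -/
lemma exists_transfer_expansion (k : Fin n → ℂ) {ξ : Fin N → ℂ} (hξ : Function.Injective ξ)
    (r : Fin N) : ∃ T : Matrix (Fin N → Fin n) (Fin N → Fin n) ℂ[X],
      (∀ η σ τ, transfer (Matrix.diagonal k) ξ η (ξ r) σ τ = η * (T σ τ).eval η) ∧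
      (∀ σ τ, (T σ τ).coeff 0 =
        if σ = τ then (∏ m ∈ univ.erase r, (ξ r - ξ m)) * k (σ r) else 0) ∧
      ∀ σ τ, σ r = τ r → (T σ τ).coeff 1 = if σ = τ then (∏ m ∈ univ.erase r, (ξ r - ξ m)) *
        k (σ r) * ∑ m ∈ univ.erase r, (if σ m = σ r then (ξ r - ξ m)⁻¹ else 0) else 0 := by
  obtain ⟨l₁, l₂, hl, hp⟩ := exists_split_finRange r
  have hmem : ∀ m ∈ l₁ ++ l₂, m ≠ r := fun m hm => by
    simpa using hp.mem_iff.1 hm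
  have hne : ∀ m ∈ l₁ ++ l₂, ξ r - ξ m ≠ 0 := fun m hm =>
    sub_ne_zero.2 fun h => hmem m hm (hξ h).symm
  have hprod : (l₁.map fun m => ξ r - ξ m).prod * (l₂.map fun m => ξ r - ξ m).prod =
      ∏ m ∈ univ.erase r, (ξ r - ξ m) := by
    rw [← List.prod_append, ← List.map_append, (hp.map _).prod_eq, Finset.prod_map_toList]
  set B := sitesPoly n ξ r l₁ * (swapOp n N r).map C * sitesPoly n ξ r l₂ with hB
  have hC0 : ((swapOp n N r).map C).map (coeff · 0) = swapOp n N r := by ext; simp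
  have hC1 : ((swapOp n N r).map C).map (coeff · 1) = 0 := by ext; simp
  have hB0 : B.map (coeff · 0) = (∏ m ∈ univ.erase r, (ξ r - ξ m)) • swapOp n N r := by
    rw [hB, map_coeff_zero_mul, map_coeff_zero_mul, hC0, map_coeff_zero_sitesPoly,
      map_coeff_zero_sitesPoly, ← hprod]
    simp only [smul_mul_assoc, one_mul, mul_smul_comm, mul_one, smul_smul, mul_comm]
  have hB1 : B.map (coeff · 1) = (∏ m ∈ univ.erase r, (ξ r - ξ m)) •
      ((l₁.map fun m => (ξ r - ξ m)⁻¹ • (swapOp n N m * swapOp n N r)).sum +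
        (l₂.map fun m => (ξ r - ξ m)⁻¹ • (swapOp n N r * swapOp n N m)).sum) := by
    rw [hB, map_coeff_one_mul, map_coeff_one_mul, map_coeff_zero_mul, hC0, hC1,
      map_coeff_zero_sitesPoly, map_coeff_zero_sitesPoly,
      map_coeff_one_sitesPoly _ _ _ fun m hm => hne m (by simp [hm]),
      map_coeff_one_sitesPoly _ _ _ fun m hm => hne m (by simp [hm]), ← hprod]
    have h₁ : (l₁.map fun m => (ξ r - ξ m)⁻¹ • (swapOp n N m * swapOp n N r)).sum =
        (l₁.map fun m => (ξ r - ξ m)⁻¹ • swapOp n N m).sum * swapOp n N r := by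
      rw [← List.sum_map_mul_right]
      simp only [smul_mul_assoc]
    have h₂ : (l₂.map fun m => (ξ r - ξ m)⁻¹ • (swapOp n N r * swapOp n N m)).sum =
        swapOp n N r * (l₂.map fun m => (ξ r - ξ m)⁻¹ • swapOp n N m).sum := by
      rw [← List.sum_map_mul_left]
      simp only [mul_smul_comm]
    rw [h₁, h₂]
    simp only [smul_mul_assoc, one_mul, mul_smul_comm, mul_one, smul_smul, mul_zero, zero_add,
      smul_add]
    rw [add_comm, mul_comm]
  refine ⟨Matrix.of fun σ τ => ∑ α, C (k α) * B (α, σ) (α, τ), fun η σ τ => ?_, fun σ τ => ?_,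
    fun σ τ h => ?_⟩
  · simp only [transfer, Matrix.of_apply, monodromy_diagonal_apply, hl, List.map_append,
      List.map_cons, List.prod_append, List.prod_cons]
    have hBe : B.map (eval η) = (l₁.map fun m => rMatrix n N η m (ξ r - ξ m)).prod * swapOp n N r *
        (l₂.map fun m => rMatrix n N η m (ξ r - ξ m)).prod := by
      rw [← map_eval_sitesPoly, ← map_eval_sitesPoly, hB]
      change (evalRingHom η).mapMatrix _ = _
      rw [map_mul, map_mul]
      congr 1
      congr 1
      ext; simp
    have hr : rMatrix n N η r (ξ r - ξ r) = η • swapOp n N r := by simp [rMatrix]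
    rw [hr, smul_mul_assoc, mul_smul_comm, ← mul_assoc, ← hBe, eval_finsetSum, Finset.mul_sum]
    refine Finset.sum_congr rfl fun α _ => ?_
    simp only [Matrix.smul_apply, Matrix.map_apply, smul_eq_mul, eval_mul, eval_C]
    ring
  · have : ∀ p q, (B p q).coeff 0 = _ := fun p q => congrFun (congrFun hB0 p) q
    simp only [Matrix.of_apply, finsetSum_coeff, coeff_C_mul, this, Matrix.smul_apply,
      smul_eq_mul, mul_left_comm (k _), ← Finset.mul_sum, sum_mul_swapOp]
    simp
  · have hB' : ∀ α, (B (α, σ) (α, τ)).coeff 1 = if α = σ r then (if σ = τ then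
        (∏ m ∈ univ.erase r, (ξ r - ξ m)) *
          ∑ m ∈ univ.erase r, (if σ m = σ r then (ξ r - ξ m)⁻¹ else 0) else 0) else 0 := by
      intro α
      have hs : (((l₁.map fun m => (ξ r - ξ m)⁻¹ • (swapOp n N m * swapOp n N r)).sum +
          (l₂.map fun m => (ξ r - ξ m)⁻¹ • (swapOp n N r * swapOp n N m)).sum :
            Matrix (AuxIndex n N) (AuxIndex n N) ℂ)) (α, σ) (α, τ) =
          ∑ m ∈ univ.erase r, (ξ r - ξ m)⁻¹ *
            if α = σ r then (if σ = τ ∧ σ m = σ r then 1 else 0) else 0 := by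
        let φ : Matrix (AuxIndex n N) (AuxIndex n N) ℂ →+ ℂ :=
          ⟨⟨fun A => A (α, σ) (α, τ), rfl⟩, fun _ _ => rfl⟩
        change φ (_ + _) = _
        rw [map_add, map_list_sum, map_list_sum, List.map_map, List.map_map,
          ← Finset.sum_map_toList, ← (hp.map _).sum_eq, List.map_append, List.sum_append]
        congr 2
        · refine List.map_congr_left fun m hm => ?_
          change (ξ r - ξ m)⁻¹ * (swapOp n N m * swapOp n N r) (α, σ) (α, τ) = _
          rw [swapOp_mul_swapOp_apply (hmem m (by simp [hm])).symm h]
        · refine List.map_congr_left fun m hm => ?_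
          change (ξ r - ξ m)⁻¹ * (swapOp n N r * swapOp n N m) (α, σ) (α, τ) = _
          rw [swapOp_mul_swapOp_apply' (hmem m (by simp [hm])).symm h]
      have := congrFun (congrFun hB1 (α, σ)) (α, τ)
      rw [Matrix.map_apply, Matrix.smul_apply, hs] at this
      rw [this]
      by_cases h1 : α = σ r <;> by_cases h2 : σ = τ <;> simp [h1, h2]
    simp only [Matrix.of_apply, finsetSum_coeff, coeff_C_mul, hB', mul_ite, mul_zero,
      Finset.sum_ite_eq', Finset.mem_univ, if_true]
    split_ifs <;> ring

end Expansion

/-! ### The determinant is a nonzero polynomial in `η` -/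

section Core

/-- Dividing the rows in `d` by `X` takes a power of `X` out of the determinant; the quotient is
invertible at `0` because its value there has trivial kernel. -/
lemma det_ne_zero_of_rows_divisible {ι : Type*} [Fintype ι] [DecidableEq ι]
    (S : Matrix ι ι ℂ[X]) (d : ι → Prop) [DecidablePred d]
    (hd : ∀ i j, d i → (S i j).coeff 0 = 0)
    (h : ∀ w : ι → ℂ, (∀ i, ∑ j, (if d i then (S i j).coeff 1 else (S i j).coeff 0) * w j = 0) →
      w = 0) : S.det ≠ 0 := by
  let G : Matrix ι ι ℂ[X] := Matrix.of fun i j => if d i then (S i j).divX else S i j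
  have hS : S = Matrix.of fun i j => (if d i then X else 1) * G i j := by
    ext1 i j
    by_cases hi : d i
    · have := X_mul_divX_add (S i j)
      rw [hd i j hi, C_0, add_zero] at this
      simp [G, hi, this]
    · simp [G, hi]
  rw [hS, Matrix.det_mul_column]
  refine mul_ne_zero (Finset.prod_ne_zero_iff.2 fun i _ => by split_ifs <;> simp) fun h0 => ?_
  have h1 : (G.map (eval 0)).det = 0 := by
    have := (evalRingHom (0 : ℂ)).map_det G
    rw [h0, map_zero] at this
    exact this.symm
  obtain ⟨w, hw, hGw⟩ := Matrix.exists_mulVec_eq_zero_iff.2 h1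
  refine hw (h w fun i => ?_)
  have := congrFun hGw i
  simp only [Matrix.mulVec, dotProduct, Matrix.map_apply, G, Matrix.of_apply,
    ← coeff_zero_eq_eval_zero, Pi.zero_apply] at this
  rw [← this]
  refine Finset.sum_congr rfl fun j _ => ?_
  split_ifs <;> simp [coeff_divX]

lemma eval_derivative_prod_X_sub_C {N : ℕ} {ξ : Fin N → ℂ} (T : Finset (Fin N)) {u : ℂ}
    (hu : ∀ l ∈ T, u - ξ l ≠ 0) :
    (derivative (∏ l ∈ T, (X - C (ξ l)))).eval u =
      (∏ l ∈ T, (u - ξ l)) * ∑ l ∈ T, (u - ξ l)⁻¹ := by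
  rw [derivative_prod_finset, eval_finsetSum, Finset.mul_sum]
  refine Finset.sum_congr rfl fun l hl => ?_
  rw [← Finset.mul_prod_erase T _ hl, mul_right_comm, mul_inv_cancel₀ (hu l hl), eval_mul, eval_prod]
  simp

/-- A polynomial of degree at most `N` that solves the degenerate quantum spectral curve at the
nodes `ξ` is constant up to its trivial zeros; an additional zero forces it to vanish. -/
lemma eq_zero_of_degenerate_curve {N : ℕ} {ξ : Fin N → ℂ} (hξ : Function.Injective ξ)
    (S : Finset (Fin N)) {Q : ℂ[X]} (hdeg : Q.natDegree ≤ N)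
    (hout : ∀ r ∉ S, Q.eval (ξ r) = 0)
    (hin : ∀ r ∈ S, (derivative Q).eval (ξ r) = Q.eval (ξ r) * ∑ l ∈ Sᶜ, (ξ r - ξ l)⁻¹)
    {z : ℂ} (hz : Q.eval z = 0)
    (hz' : ∀ j, z = ξ j → (derivative Q).eval (ξ j) = 0) : Q = 0 := by
  by_contra hQ
  set B : ℂ[X] := ∏ l ∈ Sᶜ, (X - C (ξ l)) with hB
  have hdvd : B ∣ Q := by
    refine Finset.prod_dvd_of_coprime (fun a _ b _ hab =>
      isCoprime_X_sub_C_of_isUnit_sub (sub_ne_zero.2 fun h => hab (hξ h)).isUnit) fun l hl => ?_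
    exact dvd_iff_isRoot.2 (hout l (by simpa using hl))
  obtain ⟨q, rfl⟩ := hdvd
  have hB0 : B ≠ 0 := left_ne_zero_of_mul hQ
  have hq0 : q ≠ 0 := right_ne_zero_of_mul hQ
  have hBe : ∀ u, B.eval u = ∏ l ∈ Sᶜ, (u - ξ l) := fun u => by simp [hB, eval_prod]
  have hne : ∀ r ∈ S, ∀ l ∈ Sᶜ, ξ r - ξ l ≠ 0 := fun r hr l hl => sub_ne_zero.2 fun h => by
    rw [hξ h] at hr; exact (Finset.mem_compl.1 hl) hr
  have hBr : ∀ r ∈ S, B.eval (ξ r) ≠ 0 := fun r hr => by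
    rw [hBe]; exact Finset.prod_ne_zero_iff.2 (hne r hr)
  -- The sum over `Sᶜ` is the logarithmic derivative of `B` at `ξ r`, so the condition on `Q = B *
  -- q` reduces to `q' = 0`.
  have hdq : ∀ r ∈ S, (derivative q).eval (ξ r) = 0 := fun r hr => by
    have h := hin r hr
    rw [derivative_mul, eval_add, eval_mul, eval_mul, eval_mul,
      eval_derivative_prod_X_sub_C _ (hne r hr), ← hBe] at h
    have : B.eval (ξ r) * (derivative q).eval (ξ r) = 0 := by linear_combination h
    exact (mul_eq_zero.1 this).resolve_left (hBr r hr)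
  have hdB : B.natDegree = N - S.card := by
    rw [hB, natDegree_prod_of_monic _ _ fun l _ => monic_X_sub_C _]
    simp [Finset.card_compl]
  have hS : S.card ≤ N := by simpa using Finset.card_le_univ S
  have hdegq : q.natDegree ≤ S.card := by
    rw [natDegree_mul hB0 hq0, hdB] at hdeg; omega
  -- A nonzero `q'` would have `S.card` distinct roots but degree below `S.card`.
  have hq' : derivative q = 0 := by
    by_contra h0
    have hnd : q.natDegree ≠ 0 := fun h => h0 (derivative_of_natDegree_zero h)
    have h1 : S.card ≤ (derivative q).natDegree := by
      rw [← Finset.card_image_of_injective S hξ]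
      refine card_le_degree_of_subset_roots fun a ha => ?_
      obtain ⟨r, hr, rfl⟩ := Finset.mem_image.1 (show a ∈ S.image ξ from ha)
      exact (mem_roots h0).2 (hdq r hr)
    exact absurd (natDegree_derivative_lt hnd) (by omega)
  -- If `z` is already a root of `B`, it is a node, and the double zero of `Q` there passes one zero
  -- on to `q`.
  have hqz : q.eval z = 0 := by
    by_cases hBz : B.eval z = 0
    · rw [hBe, Finset.prod_eq_zero_iff] at hBz
      obtain ⟨l, hl, hzl⟩ := hBz
      have h := hz' l (sub_eq_zero.1 hzl)
      have hsplit : B = (X - C (ξ l)) * ∏ m ∈ Sᶜ.erase l, (X - C (ξ m)) :=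
        (Finset.mul_prod_erase _ _ hl).symm
      have hl0 : (∏ m ∈ Sᶜ.erase l, (X - C (ξ m))).eval (ξ l) ≠ 0 := by
        rw [eval_prod]
        refine Finset.prod_ne_zero_iff.2 fun m hm => ?_
        rw [eval_sub, eval_X, eval_C]
        exact sub_ne_zero.2 fun h => (Finset.ne_of_mem_erase hm) (hξ h).symm
      rw [hsplit, mul_assoc, derivative_mul] at h
      simp only [derivative_sub, derivative_X, derivative_C, sub_zero, one_mul, eval_add, eval_mul,
        eval_sub, eval_X, eval_C, sub_self, zero_mul, add_zero] at h
      rw [sub_eq_zero.1 hzl]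
      exact (mul_eq_zero.1 h).resolve_left hl0
    · rw [eval_mul] at hz
      exact (mul_eq_zero.1 hz).resolve_left hBz
  have hqC := derivative_eq_zero.1 hq'
  rw [eq_C_of_natDegree_eq_zero hqC, eval_C] at hqz
  exact hq0 (by rw [eq_C_of_natDegree_eq_zero hqC, hqz, C_0])

/-- The operator-valued version of the matrices `C`, with denominators cleared in every row:
the column of a site in `J` carries no transfer matrix. -/
noncomputable def chainMatrix {n N : ℕ} (ξ : Fin N → ℂ) (k : Fin n → ℂ) (i : Fin n) (η : ℂ)
    (L : Fin N → ℂ[X]) (J : Finset (Fin N)) :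
    Matrix (Fin N × (Fin N → Fin n)) (Fin N × (Fin N → Fin n)) ℂ :=
  Matrix.of fun p q =>
    (if p.2 = q.2 then k i * aFun ξ η (ξ p.1) * (L q.1).eval (ξ p.1 - η) else 0) -
      if p.1 = q.1 ∧ q.1 ∉ J then transfer (Matrix.diagonal k) ξ η (ξ p.1) p.2 q.2 else 0

lemma coeff_one_eq_eval_derivative (p : ℂ[X]) : p.coeff 1 = (derivative p).eval 0 := by
  rw [← coeff_zero_eq_eval_zero, coeff_derivative]; simp

/-- The two determinants are treated together: `f` uses `J = ∅` and `z = x`, `g` uses `J = {j}` and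
`z = ξ j`. For a node in `J` the row equations make the zero of `Q` there double, which is why `z`
may be a node only if it lies in `J`. -/
lemma exists_polynomial_det_chainMatrix {n N : ℕ} {ξ : Fin N → ℂ} (hξ : Function.Injective ξ)
    {k : Fin n → ℂ} (hk : Function.Injective k) {i : Fin n} (hi : k i ≠ 0)
    {L : Fin N → ℂ[X]} {J : Finset (Fin N)} (hdeg : ∀ s, (L s).natDegree ≤ N)
    (hL : ∀ r s, (L s).eval (ξ r) = if r = s ∧ s ∉ J then 1 else 0)
    (hli : LinearIndependent ℂ L) {z : ℂ} (hz : ∀ s, (L s).eval z = 0)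
    (hzJ : ∀ j, z = ξ j → j ∈ J) :
    ∃ p : ℂ[X], p ≠ 0 ∧ ∀ η, (chainMatrix ξ k i η L J).det = p.eval η := by
  choose T hT hT0 hT1 using exists_transfer_expansion (n := n) k hξ
  let a : Fin N → ℂ[X] := fun r => ∏ l ∈ univ.erase r, (X - C (ξ l - ξ r))
  set A : Fin N → ℂ := fun r => ∏ l ∈ univ.erase r, (ξ r - ξ l) with hA
  have hsub : ∀ r, ∀ l ∈ univ.erase r, ξ r - ξ l ≠ 0 := fun r l hl =>
    sub_ne_zero.2 fun h => Finset.ne_of_mem_erase hl (hξ h).symm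
  have hA0 : ∀ r, A r ≠ 0 := fun r => Finset.prod_ne_zero_iff.2 (hsub r)
  have ha0 : ∀ r, (a r).coeff 0 = A r := fun r => by
    rw [coeff_zero_eq_eval_zero, eval_prod]; simp [hA]
  have ha1 : ∀ r, (a r).coeff 1 = A r * ∑ l ∈ univ.erase r, (ξ r - ξ l)⁻¹ := fun r => by
    rw [coeff_one_eq_eval_derivative, eval_derivative_prod_X_sub_C]
    · simp [hA]
    · intro l hl
      simpa using hsub r l hl
  let ℓ : Fin N → Fin N → ℂ[X] := fun r s => (L s).comp (C (ξ r) - X)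
  have hℓ0 : ∀ r s, (ℓ r s).coeff 0 = if r = s ∧ s ∉ J then 1 else 0 := fun r s => by
    rw [coeff_zero_eq_eval_zero, eval_comp, ← hL r s]; simp
  have hℓ1 : ∀ r s, (ℓ r s).coeff 1 = -(derivative (L s)).eval (ξ r) := fun r s => by
    rw [coeff_one_eq_eval_derivative, derivative_comp]; simp
  let S : Matrix (Fin N × (Fin N → Fin n)) (Fin N × (Fin N → Fin n)) ℂ[X] := Matrix.of fun p q =>
    (if p.2 = q.2 then C (k i) * a p.1 * ℓ p.1 q.1 else 0) -
      if p.1 = q.1 ∧ q.1 ∉ J then T p.1 p.2 q.2 else 0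
  have hS : ∀ η p q, chainMatrix ξ k i η L J p q = η * (S p q).eval η := by
    rintro η ⟨r, σ⟩ ⟨s, τ⟩
    have haF : aFun ξ η (ξ r) = η * (a r).eval η := by
      rw [aFun, ← Finset.mul_prod_erase univ _ (Finset.mem_univ r), eval_prod]
      congr 1
      · ring
      · exact Finset.prod_congr rfl fun l _ => by simp; ring
    have hℓe : (ℓ r s).eval η = (L s).eval (ξ r - η) := by simp [ℓ]
    simp only [chainMatrix, S, Matrix.of_apply, hT, haF, eval_sub, apply_ite (eval η), eval_mul,
      eval_C, eval_zero, hℓe]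
    split_ifs <;> ring
  -- One factor `η` comes from each row.
  refine ⟨X ^ Fintype.card (Fin N × (Fin N → Fin n)) * S.det, mul_ne_zero (by simp) ?_, fun η => ?_⟩
  swap
  · have h1 : chainMatrix ξ k i η L J = η • S.map (eval η) := by
      ext p q; simp [hS]
    have h2 : (S.map (eval η)).det = S.det.eval η := ((evalRingHom η).map_det S).symm
    rw [h1, Matrix.det_smul, h2]; simp
  have hS0 : ∀ r σ s τ, (S (r, σ) (s, τ)).coeff 0 =
      if r = s ∧ s ∉ J then (if σ = τ then A r * (k i - k (σ r)) else 0) else 0 := by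
    intro r σ s τ
    simp only [S, Matrix.of_apply, coeff_sub, apply_ite (fun p : ℂ[X] => p.coeff 0), coeff_zero,
      mul_coeff_zero, coeff_C_zero, ha0, hℓ0, hT0]
    split_ifs with h1 h2 <;> ring
  have hC1 : (C (k i)).coeff 1 = 0 := coeff_C_succ
  have hS1 : ∀ r σ s τ, (S (r, σ) (s, τ)).coeff 1 =
      (if σ = τ then k i * A r * ((∑ l ∈ univ.erase r, (ξ r - ξ l)⁻¹) * (L s).eval (ξ r) -
        (derivative (L s)).eval (ξ r)) else 0) -
      if r = s ∧ s ∉ J then (T r σ τ).coeff 1 else 0 := by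
    intro r σ s τ
    simp only [S, Matrix.of_apply, coeff_sub, apply_ite (fun p : ℂ[X] => p.coeff 1), coeff_zero,
      mul_coeff_one, mul_coeff_zero, coeff_C_zero, hC1, zero_mul, add_zero, ha0, ha1, hℓ1,
      coeff_zero_eq_eval_zero (ℓ r s)]
    have : (ℓ r s).eval 0 = (L s).eval (ξ r) := by simp [ℓ]
    rw [this]
    congr 2
    ring
  -- In order zero the row `(r, σ)` is diagonal with entry `A r * (k i - k (σ r))`, or entirely zero
  -- if `r ∈ J`.
  refine det_ne_zero_of_rows_divisible S (fun p => p.2 p.1 = i ∨ p.1 ∈ J) ?_ fun w hw => ?_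
  · rintro ⟨r, σ⟩ ⟨s, τ⟩ h
    rw [hS0]
    split_ifs with h1 h2
    · have h3 : σ r = i := h.resolve_right (h1.1 ▸ h1.2)
      simp [h3]
    · rfl
    · rfl
  have hw0 : ∀ r σ, ¬(σ r = i ∨ r ∈ J) → w (r, σ) = 0 := by
    intro r σ h
    have h' := hw (r, σ)
    rw [not_or] at h
    simp only [h, or_self, if_false, Fintype.sum_prod_type, hS0] at h'
    have : A r * (k i - k (σ r)) * w (r, σ) = 0 := by
      rw [← h', Finset.sum_eq_single r, Finset.sum_eq_single σ]
      · simp [h.2]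
      · intro τ _ hτ; simp [hτ.symm]
      · simp
      · intro s _ hs; simp [hs.symm]
      · simp
    exact (mul_eq_zero.1 this).resolve_left
      (mul_ne_zero (hA0 r) (sub_ne_zero.2 fun h' => h.1 (hk h').symm))
  let Q : (Fin N → Fin n) → ℂ[X] := fun σ => ∑ s, w (s, σ) • L s
  have hQe : ∀ σ u, (Q σ).eval u = ∑ s, w (s, σ) * (L s).eval u := fun σ u => by
    simp [Q, eval_finsetSum]
  have hQd : ∀ σ u, (derivative (Q σ)).eval u = ∑ s, w (s, σ) * (derivative (L s)).eval u :=
    fun σ u => by simp [Q, eval_finsetSum]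
  have hQr : ∀ σ r, (Q σ).eval (ξ r) = if r ∈ J then 0 else w (r, σ) := fun σ r => by
    simp only [hQe, hL, mul_ite, mul_one, mul_zero, ite_and]
    rw [Finset.sum_ite_eq]
    simp
  have hmain : ∀ σ, ∀ r, (σ r = i ∨ r ∈ J) → k i * A r *
      ((∑ l ∈ univ.erase r, (ξ r - ξ l)⁻¹) * (Q σ).eval (ξ r) - (derivative (Q σ)).eval (ξ r)) =
      if r ∈ J then 0 else ∑ τ, (T r σ τ).coeff 1 * w (r, τ) := by
    intro σ r h
    have h' := hw (r, σ)
    simp only [h, if_true, Fintype.sum_prod_type, hS1, sub_mul, Finset.sum_sub_distrib, ite_mul,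
      zero_mul, Finset.sum_ite_eq, Finset.mem_univ] at h'
    have h2 : (∑ s, ∑ τ, if r = s ∧ s ∉ J then (T r σ τ).coeff 1 * w (s, τ) else 0) =
        if r ∈ J then 0 else ∑ τ, (T r σ τ).coeff 1 * w (r, τ) := by
      rw [Finset.sum_eq_single r]
      · by_cases hr : r ∈ J <;> simp [hr]
      · intro s _ hs; simp [hs.symm]
      · simp
    rw [h2, sub_eq_zero] at h'
    rw [← h', hQe, hQd, Finset.mul_sum univ _ (∑ l ∈ univ.erase r, (ξ r - ξ l)⁻¹),
      ← Finset.sum_sub_distrib, Finset.mul_sum]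
    exact Finset.sum_congr rfl fun s _ => by ring
  have hQ0 : ∀ σ, Q σ = 0 := by
    intro σ
    refine eq_zero_of_degenerate_curve hξ (univ.filter fun l => σ l = i) ?_ ?_ ?_
      (z := z) ?_ ?_
    · exact natDegree_sum_le_of_forall_le _ _ fun s _ =>
        (natDegree_smul_le _ _).trans (hdeg s)
    · intro r hr
      rw [hQr]
      split_ifs with h
      · rfl
      · exact hw0 r σ (by simpa [h] using hr)
    · intro r hr
      have hr' : σ r = i := by simpa using hr
      have hm := hmain σ r (Or.inl hr')
      by_cases hJ : r ∈ J
      · rw [hQr, if_pos hJ, if_pos hJ, mul_zero, zero_sub] at hm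
        rw [hQr, if_pos hJ, zero_mul]
        exact neg_eq_zero.1 ((mul_eq_zero.1 hm).resolve_left (mul_ne_zero hi (hA0 r)))
      -- Terms with `τ r ≠ i` drop out because `w (r, τ) = 0`; those with `τ r = i` have `σ r = τ
      -- r`, where the first-order coefficient is diagonal. The equations for different `σ`
      -- therefore decouple.
      have hT' : ∑ τ, (T r σ τ).coeff 1 * w (r, τ) = k i * A r *
          ((∑ l ∈ univ.erase r, if σ l = i then (ξ r - ξ l)⁻¹ else 0) * (Q σ).eval (ξ r)) := by
        rw [hQr, if_neg hJ, Finset.sum_eq_single σ]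
        · rw [hT1 r σ σ rfl, if_pos rfl, hr']
          ring
        · intro τ _ hτ
          by_cases hτr : τ r = i
          · rw [hT1 r σ τ (hr'.trans hτr.symm), if_neg hτ.symm, zero_mul]
          · rw [hw0 r τ (by simp [hτr, hJ]), mul_zero]
        · simp
      rw [if_neg hJ, hT'] at hm
      have hm' := mul_left_cancel₀ (mul_ne_zero hi (hA0 r)) hm
      -- The sites with `σ l = i` cancel between `a` and the transfer matrix, leaving those with `σ
      -- l ≠ i`.
      have hsum : ∑ l ∈ (univ.filter fun l => σ l = i)ᶜ, (ξ r - ξ l)⁻¹ =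
          (∑ l ∈ univ.erase r, (ξ r - ξ l)⁻¹) -
            ∑ l ∈ univ.erase r, if σ l = i then (ξ r - ξ l)⁻¹ else 0 := by
        rw [← Finset.sum_sub_distrib, Finset.compl_filter, Finset.sum_filter,
          ← Finset.add_sum_erase univ _ (Finset.mem_univ r)]
        simp only [hr', not_true, if_false, zero_add]
        exact Finset.sum_congr rfl fun l _ => by split_ifs <;> simp
      rw [hsum]
      linear_combination -hm'
    · simp [hQe, hz]
    · intro j hj
      have hJ := hzJ j hj
      have := hmain σ j (Or.inr hJ)
      rw [hQr, if_pos hJ, if_pos hJ, mul_zero, zero_sub] at this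
      exact neg_eq_zero.1 ((mul_eq_zero.1 this).resolve_left (mul_ne_zero hi (hA0 j)))
  funext ⟨s, σ⟩
  exact Fintype.linearIndependent_iff.1 hli (fun s => w (s, σ)) (hQ0 σ) s

end Core

open MeasureTheory

/-! ### From the operator-valued determinant to `fDet` and `gDet` -/

section Nonvanishing

variable {n N : ℕ}

/-- A null vector `w` of the scalar matrix and the eigenvector `v` combine to the null vector `w ⊗
v`, since the transfer matrix acts on `v` as `t (ξ r)`. -/
lemma det_chainMatrix_eq_zero {ξ : Fin N → ℂ} {k : Fin n → ℂ} {i : Fin n} {η : ℂ} {t : ℂ → ℂ}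
    {L : Fin N → ℂ[X]} {J : Finset (Fin N)}
    (ht : IsTransferEigenvalue (Matrix.diagonal k) ξ η t) (hi : k i ≠ 0)
    (ha : ∀ r, aFun ξ η (ξ r) ≠ 0)
    (h : (Matrix.of fun r s => (L s).eval (ξ r - η) -
      if r = s ∧ s ∉ J then t (ξ r) / (k i * aFun ξ η (ξ r)) else 0).det = 0) :
    (chainMatrix ξ k i η L J).det = 0 := by
  obtain ⟨v, hv, hT⟩ := ht
  obtain ⟨w, hw, hM⟩ := Matrix.exists_mulVec_eq_zero_iff.2 h
  refine Matrix.exists_mulVec_eq_zero_iff.1 ⟨fun p => w p.1 * v p.2, fun h0 => ?_, ?_⟩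
  · obtain ⟨s, hs⟩ := Function.ne_iff.1 hw
    obtain ⟨τ, hτ⟩ := Function.ne_iff.1 hv
    exact mul_ne_zero hs hτ (congrFun h0 (s, τ))
  · funext ⟨r, σ⟩
    have h1 := congrFun hM r
    have h2 : ∑ τ, transfer (Matrix.diagonal k) ξ η (ξ r) σ τ * v τ = t (ξ r) * v σ :=
      congrFun (hT (ξ r)) σ
    have hd : k i * aFun ξ η (ξ r) ≠ 0 := mul_ne_zero hi (ha r)
    simp only [Matrix.mulVec, dotProduct, Matrix.of_apply, Pi.zero_apply, sub_mul,
      Finset.sum_sub_distrib, ite_mul, zero_mul] at h1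
    simp only [Matrix.mulVec, dotProduct, chainMatrix, Matrix.of_apply, Pi.zero_apply, sub_mul,
      Finset.sum_sub_distrib, ite_mul, zero_mul, Fintype.sum_prod_type, Finset.sum_ite_eq,
      Finset.mem_univ, if_true]
    have h3 : (∑ s, ∑ τ, if r = s ∧ s ∉ J then
        transfer (Matrix.diagonal k) ξ η (ξ r) σ τ * (w s * v τ) else 0) =
        k i * aFun ξ η (ξ r) * v σ *
          ∑ s, if r = s ∧ s ∉ J then t (ξ r) / (k i * aFun ξ η (ξ r)) * w s else 0 := by
      rw [Finset.mul_sum]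
      refine Finset.sum_congr rfl fun s _ => ?_
      split_ifs with hs
      · simp_rw [mul_left_comm _ (w s), ← Finset.mul_sum, h2]
        have := ha r
        field_simp
      · simp
    rw [h3]
    have h4 : ∑ s, k i * aFun ξ η (ξ r) * eval (ξ r - η) (L s) * (w s * v σ) =
        k i * aFun ξ η (ξ r) * v σ * ∑ s, eval (ξ r - η) (L s) * w s := by
      rw [Finset.mul_sum]
      exact Finset.sum_congr rfl fun s _ => by ring
    rw [h4, ← mul_sub, h1, mul_zero]

lemma ext_injective {ξ : Fin N → ℂ} (hξ : Function.Injective ξ) {x : ℂ} (hx : x ∉ Set.range ξ) :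
    Function.Injective (ext ξ x) := by
  rw [ext, Fin.snoc_injective_iff]
  exact ⟨hξ, hx⟩

/-- The Lagrange polynomials of the nodes `ξ_1, …, ξ_N, x`, without that of `x`. -/
noncomputable def lagrangeExt (ξ : Fin N → ℂ) (x : ℂ) (s : Fin N) : ℂ[X] :=
  Lagrange.basis univ (ext ξ x) s.castSucc

/-- The Lagrange polynomials of the nodes `ξ`, that of `ξ j` replaced by the nodal polynomial. -/
noncomputable def lagrangeNodal (ξ : Fin N → ℂ) (j s : Fin N) : ℂ[X] :=
  if s = j then Lagrange.nodal univ ξ else Lagrange.basis univ ξ s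

lemma eval_basis {ι : Type*} [DecidableEq ι] (T : Finset ι) (v : ι → ℂ) (i : ι) (u : ℂ) :
    (Lagrange.basis T v i).eval u = ∏ c ∈ T.erase i, (u - v c) / (v i - v c) := by
  rw [Lagrange.basis, eval_prod]
  exact Finset.prod_congr rfl fun c _ => by
    simp [Lagrange.basisDivisor, div_eq_mul_inv, mul_comm]

lemma exists_polynomial_det_chainMatrix_lagrangeExt {ξ : Fin N → ℂ} (hξ : Function.Injective ξ)
    {k : Fin n → ℂ} (hk : Function.Injective k) {i : Fin n} (hi : k i ≠ 0) {x : ℂ}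
    (hx : x ∉ Set.range ξ) :
    ∃ p : ℂ[X], p ≠ 0 ∧ ∀ η, (chainMatrix ξ k i η (lagrangeExt ξ x) ∅).det = p.eval η := by
  have hinj := ext_injective hξ hx
  have hL : ∀ r s : Fin N, (lagrangeExt ξ x s).eval (ξ r) = if r = s then 1 else 0 := by
    intro r s
    rw [← ext_castSucc ξ x r, lagrangeExt]
    split_ifs with h
    · rw [h, Lagrange.eval_basis_self hinj.injOn (Finset.mem_univ _)]
    · exact Lagrange.eval_basis_of_ne (fun h' => h (Fin.castSucc_injective _ h').symm)
        (Finset.mem_univ _)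
  refine exists_polynomial_det_chainMatrix hξ hk hi (fun s => ?_) (fun r s => by simp [hL])
    ?_ (z := x) (fun s => ?_) fun j hj => absurd ⟨j, hj.symm⟩ hx
  · refine natDegree_le_of_degree_le ?_
    rw [lagrangeExt, Lagrange.degree_basis hinj.injOn (Finset.mem_univ _)]
    simp
  · refine Fintype.linearIndependent_iff.2 fun g hg s => ?_
    have := congrArg (eval (ξ s)) hg
    simpa [eval_finsetSum, hL] using this
  · have := Lagrange.eval_basis_of_ne (s := univ) (v := ext ξ x) (Fin.castSucc_ne_last s)
      (Finset.mem_univ _)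
    rwa [ext_last] at this

lemma exists_polynomial_det_chainMatrix_lagrangeNodal {ξ : Fin N → ℂ}
    (hξ : Function.Injective ξ) {k : Fin n → ℂ} (hk : Function.Injective k) {i : Fin n}
    (hi : k i ≠ 0) (j : Fin N) :
    ∃ p : ℂ[X], p ≠ 0 ∧ ∀ η, (chainMatrix ξ k i η (lagrangeNodal ξ j) {j}).det = p.eval η := by
  have hL : ∀ r s : Fin N, (lagrangeNodal ξ j s).eval (ξ r) =
      if r = s ∧ s ∉ ({j} : Finset (Fin N)) then 1 else 0 := by
    intro r s
    simp only [lagrangeNodal, Finset.mem_singleton]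
    by_cases hs : s = j
    · simp [hs, Lagrange.eval_nodal_at_node]
    · by_cases hr : r = s
      · simp [hr, hs, Lagrange.eval_basis_self hξ.injOn]
      · simp [hr, hs, Lagrange.eval_basis_of_ne (Ne.symm hr)]
  refine exists_polynomial_det_chainMatrix hξ hk hi (fun s => ?_) hL
    ?_ (z := ξ j) (fun s => ?_) fun l hl => by simp [hξ hl]
  · rw [lagrangeNodal]
    split_ifs
    · refine natDegree_le_of_degree_le ?_
      rw [Lagrange.degree_nodal]; simp
    · refine natDegree_le_of_degree_le ?_
      rw [Lagrange.degree_basis hξ.injOn (Finset.mem_univ _)]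
      simp
  · refine Fintype.linearIndependent_iff.2 fun g hg => ?_
    have h1 : ∀ s, s ≠ j → g s = 0 := fun s hs => by
      have := congrArg (eval (ξ s)) hg
      simpa [eval_finsetSum, hL, ite_and, hs] using this
    intro s
    by_cases hs : s = j
    · rw [Finset.sum_eq_single j (fun s _ hs => by rw [h1 s hs, zero_smul]) (by simp),
        lagrangeNodal, if_pos rfl] at hg
      rw [hs]
      exact (smul_eq_zero.1 hg).resolve_right Lagrange.nodal_ne_zero
    · exact h1 s hs
  · rw [hL]
    simp only [Finset.mem_singleton]
    exact if_neg fun h => h.2 h.1.symm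

lemma normalization_ne_zero {ξ : Fin N → ℂ} (hξ : Function.Injective ξ) {x : ℂ}
    (hx : x ∉ Set.range ξ) : normalization ξ x ≠ 0 := by
  refine Finset.prod_ne_zero_iff.2 fun a _ => Finset.prod_ne_zero_iff.2 fun b hb => ?_
  rw [← ext_castSucc ξ x a]
  exact sub_ne_zero.2 fun h => Finset.ne_of_mem_erase hb (ext_injective hξ hx h).symm

lemma fDet_ne_zero {ξ : Fin N → ℂ} (hξ : Function.Injective ξ) {x : ℂ} (hx : x ∉ Set.range ξ)
    {k : Fin n → ℂ} {i : Fin n} (hi : k i ≠ 0) {η : ℂ} (ha : ∀ r, aFun ξ η (ξ r) ≠ 0)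
    {t : ℂ → ℂ} (ht : IsTransferEigenvalue (Matrix.diagonal k) ξ η t)
    (h : (chainMatrix ξ k i η (lagrangeExt ξ x) ∅).det ≠ 0) : fDet ξ (k i) η t x ≠ 0 := by
  refine mul_ne_zero (normalization_ne_zero hξ hx) fun h0 =>
    h (det_chainMatrix_eq_zero ht hi ha ?_)
  refine Eq.trans ?_ h0
  congr 1
  ext r s
  simp only [cMatrix, Matrix.of_apply, lagrangeExt, eval_basis, ext_castSucc, Finset.notMem_empty,
    not_false_eq_true, and_true, sub_right_comm (ξ r) η]
  ring

lemma gDet_ne_zero {ξ : Fin N → ℂ} (hξ : Function.Injective ξ) {x : ℂ} (hx : x ∉ Set.range ξ)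
    {k : Fin n → ℂ} {i : Fin n} (hi : k i ≠ 0) {η : ℂ} (ha : ∀ r, aFun ξ η (ξ r) ≠ 0)
    {t : ℂ → ℂ} (ht : IsTransferEigenvalue (Matrix.diagonal k) ξ η t) {j : Fin N}
    (h : (chainMatrix ξ k i η (lagrangeNodal ξ j) {j}).det ≠ 0) : gDet ξ (k i) η t j x ≠ 0 := by
  refine mul_ne_zero (normalization_ne_zero hξ hx) ?_
  rw [det_cMatrixCol ξ (k i) η t j hx]
  refine mul_ne_zero (neg_ne_zero.2 (inv_ne_zero (Finset.prod_ne_zero_iff.2 fun l _ =>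
    sub_ne_zero.2 fun h => hx ⟨l, h.symm⟩))) fun h0 => h (det_chainMatrix_eq_zero ht hi ha ?_)
  refine Eq.trans ?_ h0
  congr 1
  ext r s
  by_cases hs : s = j
  · subst hs
    simp [baseMatrixCol, lagrangeNodal, Lagrange.eval_nodal, sub_right_comm (ξ r) η]
  · simp only [baseMatrixCol, Matrix.updateCol_ne hs, baseMatrix, Matrix.of_apply, lagrangeNodal,
      eval_basis, lagrangeShift, Finset.mem_singleton, hs, if_false, not_false_eq_true, and_true,
      sub_right_comm (ξ r) η]
    ring

end Nonvanishing

/-! ### Almost all parameters -/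

section Measure

variable {n N : ℕ}

lemma measurable_det {Ω ι : Type*} [MeasurableSpace Ω] [Fintype ι] [DecidableEq ι]
    {A : Ω → Matrix ι ι ℂ} (hA : ∀ p q, Measurable fun ω => A ω p q) :
    Measurable fun ω => (A ω).det := by
  simp_rw [Matrix.det_apply]
  exact Finset.measurable_fun_sum _ fun π _ =>
    (Finset.measurable_fun_prod _ fun p _ => hA (π p) p).const_smul _

lemma continuous_transfer_diagonal (r : Fin N) :
    Continuous fun θ : (Fin N → ℂ) × (Fin n → ℂ) × ℂ =>
      transfer (Matrix.diagonal θ.2.1) θ.1 θ.2.2 (θ.1 r) := by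
  have hM : Continuous fun θ : (Fin N → ℂ) × (Fin n → ℂ) × ℂ =>
      ((List.finRange N).reverse.map fun m => rMatrix n N θ.2.2 m (θ.1 r - θ.1 m)).prod := by
    refine continuous_list_prod _ fun m _ => ?_
    unfold rMatrix
    fun_prop
  refine continuous_matrix fun σ τ => ?_
  simp only [transfer, Matrix.of_apply, monodromy_diagonal_apply]
  refine continuous_finsetSum _ fun α _ => Continuous.mul (by fun_prop) ?_
  exact hM.matrix_elem _ _

lemma measurable_det_chainMatrix (i : Fin n) (L : (Fin N → ℂ) → Fin N → ℂ[X])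
    (J : Finset (Fin N))
    (hL : ∀ r s, Measurable fun θ : (Fin N → ℂ) × ℂ => (L θ.1 s).eval (θ.1 r - θ.2)) :
    Measurable fun θ : (Fin N → ℂ) × (Fin n → ℂ) × ℂ =>
      (chainMatrix θ.1 θ.2.1 i θ.2.2 (L θ.1) J).det := by
  refine measurable_det fun p q => ?_
  have h1 : Measurable fun θ : (Fin N → ℂ) × (Fin n → ℂ) × ℂ =>
      (L θ.1 q.1).eval (θ.1 p.1 - θ.2.2) :=
    (hL p.1 q.1).comp (measurable_fst.prodMk (measurable_snd.comp measurable_snd))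
  have h2 : Measurable fun θ : (Fin N → ℂ) × (Fin n → ℂ) × ℂ => aFun θ.1 θ.2.2 (θ.1 p.1) := by
    unfold aFun
    fun_prop
  have h3 := ((continuous_transfer_diagonal (n := n) p.1).matrix_elem p.2 q.2).measurable
  simp only [chainMatrix, Matrix.of_apply]
  split_ifs <;> fun_prop

/-- For almost every `(ξ, k)` the zeros in `η` form a finite set; Fubini applies because `F` is
measurable. -/
lemma ae_ne_zero_of_polynomial {F : (Fin N → ℂ) × (Fin n → ℂ) × ℂ → ℂ} (hF : Measurable F)
    {P : (Fin N → ℂ) → Prop} {P' : (Fin n → ℂ) → Prop} (hP : ∀ᵐ ξ, P ξ) (hP' : ∀ᵐ k, P' k)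
    (h : ∀ ξ k, P ξ → P' k → ∃ p : ℂ[X], p ≠ 0 ∧ ∀ η, F (ξ, k, η) = p.eval η) :
    ∀ᵐ θ, F θ ≠ 0 := by
  have hm : MeasurableSet {θ | F θ ≠ 0} := (hF (measurableSet_singleton 0)).compl
  refine (Measure.ae_prod_iff_ae_ae hm).2 ?_
  filter_upwards [hP] with ξ hξ
  refine (Measure.ae_prod_iff_ae_ae (measurable_prodMk_left hm)).2 ?_
  filter_upwards [hP'] with k hk
  obtain ⟨p, hp, hpF⟩ := h ξ k hξ hk
  have hr := p.roots.toFinset.finite_toSet.measure_zero volume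
  filter_upwards [measure_eq_zero_iff_ae_notMem.1 hr] with η hη h0
  rw [hpF] at h0
  exact hη (by simpa [hp] using h0)

lemma ae_injective (m : ℕ) : ∀ᵐ v : Fin m → ℂ, Function.Injective v := by
  have h : ∀ a b : Fin m, a ≠ b → ∀ᵐ v : Fin m → ℂ, v a ≠ v b := by
    intro a b hab
    -- The coincidence locus is a proper real subspace, hence null for Lebesgue measure.
    let φ : (Fin m → ℂ) →ₗ[ℝ] ℂ :=
      LinearMap.proj (R := ℝ) (φ := fun _ : Fin m => ℂ) a - LinearMap.proj b
    have hφ : LinearMap.ker φ ≠ ⊤ := fun h => by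
      have : Pi.single a (1 : ℂ) ∈ LinearMap.ker φ := h ▸ Submodule.mem_top
      simp [φ, hab.symm] at this
    have := Measure.addHaar_submodule volume (LinearMap.ker φ) hφ
    refine measure_mono_null (fun v hv => ?_) this
    simpa [φ, sub_eq_zero] using hv
  have h' : ∀ᵐ v : Fin m → ℂ, ∀ a b, a ≠ b → v a ≠ v b := by
    simp only [ae_all_iff]
    exact h
  filter_upwards [h'] with v hv a b hab
  by_contra hne
  exact hv a b hne hab

lemma ae_notMem_range (m : ℕ) (x : ℂ) : ∀ᵐ v : Fin m → ℂ, x ∉ Set.range v := by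
  have : ∀ᵐ v : Fin m → ℂ, ∀ a, v a ≠ x := ae_all_iff.2 fun a =>
    (Measure.quasiMeasurePreserving_eval (fun _ : Fin m => (volume : Measure ℂ)) a).ae
      (Measure.ae_ne volume x)
  filter_upwards [this] with v hv
  rintro ⟨a, ha⟩
  exact hv a ha

end Measure

end GlnChain

theorem mainTheorem6 (n N : ℕ) :
    -- polynomiality in `x = ξ_{N+1}`, wherever the matrix entries are defined
    (∀ (ξ : Fin N → ℂ) (k : Fin n → ℂ) (η : ℂ) (K : Matrix (Fin n) (Fin n) ℂ) (t : ℂ → ℂ)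
        (i : Fin n),
      K.charpoly = ∏ m : Fin n, (Polynomial.X - Polynomial.C (k m)) →
      GlnChain.IsTransferEigenvalue K ξ η t →
      Function.Injective ξ → k i ≠ 0 → (∀ r : Fin N, GlnChain.aFun ξ η (ξ r) ≠ 0) →
      (∃ p : Polynomial ℂ, ∀ x : ℂ, x ∉ Set.range ξ →
        GlnChain.fDet ξ (k i) η t x = p.eval x) ∧
      (∀ j : Fin N, ∃ q : Polynomial ℂ, ∀ x : ℂ, x ∉ Set.range ξ →
        GlnChain.gDet ξ (k i) η t j x = q.eval x)) ∧
    -- nonvanishing, for all but finitely many `x = ξ_{N+1}`, for almost all other parameters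
    (∀ᶠ x : ℂ in Filter.cofinite,
      ∀ᵐ θ : (Fin N → ℂ) × (Fin n → ℂ) × ℂ ∂MeasureTheory.volume,
        ∀ (K : Matrix (Fin n) (Fin n) ℂ) (t : ℂ → ℂ) (i : Fin n),
          K.charpoly = ∏ m : Fin n, (Polynomial.X - Polynomial.C (θ.2.1 m)) →
          GlnChain.IsTransferEigenvalue K θ.1 θ.2.2 t →
          GlnChain.fDet θ.1 (θ.2.1 i) θ.2.2 t x ≠ 0 ∧
          ∀ j : Fin N, GlnChain.gDet θ.1 (θ.2.1 i) θ.2.2 t j x ≠ 0) := by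
  open GlnChain MeasureTheory in
  refine ⟨fun ξ k η K t i _ _ _ _ _ => ⟨exists_polynomial_fDet ξ (k i) η t,
    fun j => exists_polynomial_gDet ξ (k i) η t j⟩, Filter.Eventually.of_forall fun x => ?_⟩
  -- No value of `x` is exceptional: each fixed `x` avoids the nodes for almost every `ξ`.
  have hP : ∀ᵐ ξ : Fin N → ℂ, Function.Injective ξ ∧ x ∉ Set.range ξ :=
    (ae_injective N).and (ae_notMem_range N x)
  have hP' : ∀ᵐ k : Fin n → ℂ, Function.Injective k ∧ (0 : ℂ) ∉ Set.range k :=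
    (ae_injective n).and (ae_notMem_range n 0)
  have hk0 : ∀ {k : Fin n → ℂ}, (0 : ℂ) ∉ Set.range k → ∀ i, k i ≠ 0 := fun h i hi => h ⟨i, hi⟩
  have hξ : ∀ᵐ θ : (Fin N → ℂ) × (Fin n → ℂ) × ℂ, Function.Injective θ.1 ∧ x ∉ Set.range θ.1 :=
    Measure.quasiMeasurePreserving_fst.ae hP
  have hk : ∀ᵐ θ : (Fin N → ℂ) × (Fin n → ℂ) × ℂ,
      Function.Injective θ.2.1 ∧ (0 : ℂ) ∉ Set.range θ.2.1 :=
    (Measure.quasiMeasurePreserving_fst.comp Measure.quasiMeasurePreserving_snd).ae hP'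
  have ha : ∀ r, ∀ᵐ θ : (Fin N → ℂ) × (Fin n → ℂ) × ℂ, aFun θ.1 θ.2.2 (θ.1 r) ≠ 0 := fun r => by
    refine ae_ne_zero_of_polynomial (by unfold aFun; fun_prop) hP hP' fun ξ k _ _ =>
      ⟨∏ l, (Polynomial.X + Polynomial.C (ξ r - ξ l)),
        Finset.prod_ne_zero_iff.2 fun l _ => Polynomial.X_add_C_ne_zero _, fun η => ?_⟩
    rw [aFun, Polynomial.eval_prod]
    exact Finset.prod_congr rfl fun l _ => by simp; ring
  have hf : ∀ i, ∀ᵐ θ : (Fin N → ℂ) × (Fin n → ℂ) × ℂ,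
      (chainMatrix θ.1 θ.2.1 i θ.2.2 (lagrangeExt θ.1 x) ∅).det ≠ 0 := fun i => by
    refine ae_ne_zero_of_polynomial
      (measurable_det_chainMatrix i (fun ξ => lagrangeExt ξ x) ∅ fun r s => ?_) hP hP'
      fun ξ k hξ hk =>
        exists_polynomial_det_chainMatrix_lagrangeExt hξ.1 hk.1 (hk0 hk.2 i) hξ.2
    simp only [lagrangeExt, eval_basis, prod_erase_castSucc, ext_castSucc, ext_last]
    fun_prop
  have hg : ∀ i j, ∀ᵐ θ : (Fin N → ℂ) × (Fin n → ℂ) × ℂ,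
      (chainMatrix θ.1 θ.2.1 i θ.2.2 (lagrangeNodal θ.1 j) {j}).det ≠ 0 := fun i j => by
    refine ae_ne_zero_of_polynomial
      (measurable_det_chainMatrix i (fun ξ => lagrangeNodal ξ j) {j} fun r s => ?_) hP hP'
      fun ξ k hξ hk =>
        exists_polynomial_det_chainMatrix_lagrangeNodal hξ.1 hk.1 (hk0 hk.2 i) j
    simp only [lagrangeNodal]
    split_ifs
    · simp only [Lagrange.eval_nodal]
      fun_prop
    · simp only [eval_basis]
      fun_prop
  filter_upwards [hξ, hk, ae_all_iff.2 ha, ae_all_iff.2 hf,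
    ae_all_iff.2 fun i => ae_all_iff.2 (hg i)] with θ hξ hk ha hf hg K t i hK ht
  obtain ⟨P, Q, hPK, hQP⟩ := exists_diagonalization hk.1 hK
  have ht' := ht.of_similar hPK hQP
  exact ⟨fDet_ne_zero hξ.1 hξ.2 (hk0 hk.2 i) ha ht' (hf i),
    fun j => gDet_ne_zero hξ.1 hξ.2 (hk0 hk.2 i) ha ht' (hg i j)⟩
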